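/- Let $F_3$ be the free group on $x_1,x_2,x_3$, and let $B_3=\langle \sigma_1,\sigma_2 \mid \sigma_1\sigma_2\sigma_1=\sigma_2\sigma_1\sigma_2\rangle$ be the braid group on three strands. Let $B_3$ act on $F_3$ from the right by automorphisms (the Artin action), where for $i\in\{1,2\}$ $$x_i^{\sigma_i}=x_ix_{i+1}x_i^{-1},\qquad x_{i+1}^{\sigma_i}=x_i,\qquad x_j^{\sigma_i}=x_j\quad (j\neq i,i+1).$$ A bi-ordering of a group $G$ is a strict total ordering $<$ of $G$ such that $f<g$ implies $hf<hg$ and $fh<gh$ for all $f,g,h\in G$. A braid $\beta\in B_3$ is called order-preserving if there is a bi-ordering $<$ of $F_3$ such that, for all $f,g\in F_3$, $f<g$ if and only if $f^\beta<g^\beta$. **Theorem.** For every integer $n$, the braid $\sigma_1^2\sigma_2^{\,n}\in B_3$ is order-preserving. -/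

import Mathlib

/-- A bi-ordering of a group: a strict total order invariant under left and right multiplication. -/
structure IsBiOrdering {G : Type*} [Group G] (lt : G → G → Prop) : Prop where
  strictTotal : IsStrictTotalOrder G lt
  mul_left : ∀ f g h : G, lt f g → lt (h * f) (h * g)
  mul_right : ∀ f g h : G, lt f g → lt (f * h) (g * h)

/-- An automorphism of a group is order-preserving if it preserves some bi-ordering. -/
def IsOrderPreserving {G : Type*} [Group G] (φ : G ≃* G) : Prop :=
  ∃ lt : G → G → Prop, IsBiOrdering lt ∧ ∀ f g : G, lt f g ↔ lt (φ f) (φ g)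

/-- The braid relations on `n` strands. Generators are numbered from `0`: the index `i`
stands for the generator usually written `σ_{i+1}`. -/
def braidRels (n : ℕ) : Set (FreeGroup (Fin (n - 1))) :=
  {r | ∃ i j : Fin (n - 1), i.val + 1 = j.val ∧
    r = .of i * .of j * .of i * (.of j * .of i * .of j)⁻¹} ∪
  {r | ∃ i j : Fin (n - 1), (i.val + 1 < j.val ∨ j.val + 1 < i.val) ∧
    r = .of i * .of j * (.of j * .of i)⁻¹}

/-- The braid group `B_n`, by Artin's presentation. -/
abbrev BraidGroup (n : ℕ) : Type := PresentedGroup (braidRels n)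

/-- The Artin generators (numbered from `0`). -/
def BraidGroup.σ {n : ℕ} (i : Fin (n - 1)) : BraidGroup n := PresentedGroup.of i

/-- The free generators `x_0, …, x_{n-1}` of `F_n` are acted on by the generator with index `i`
through `x_i ↦ x_i x_{i+1} x_i⁻¹`, `x_{i+1} ↦ x_i`, `x_j ↦ x_j` otherwise. -/
def artinGenHom {n : ℕ} (i : Fin (n - 1)) : FreeGroup (Fin n) →* FreeGroup (Fin n) :=
  FreeGroup.lift fun j =>
    if j.val = i.val then
      .of ⟨i.val, by omega⟩ * .of ⟨i.val + 1, by omega⟩ * (.of ⟨i.val, by omega⟩)⁻¹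
    else if j.val = i.val + 1 then .of ⟨i.val, by omega⟩
    else .of j

/-- The inverse of `artinGenHom i`. -/
def artinGenInvHom {n : ℕ} (i : Fin (n - 1)) : FreeGroup (Fin n) →* FreeGroup (Fin n) :=
  FreeGroup.lift fun j =>
    if j.val = i.val then .of ⟨i.val + 1, by omega⟩
    else if j.val = i.val + 1 then
      (.of ⟨i.val + 1, by omega⟩)⁻¹ * .of ⟨i.val, by omega⟩ * .of ⟨i.val + 1, by omega⟩
    else .of j

theorem artinGenInvHom_comp {n : ℕ} (i : Fin (n - 1)) :
    (artinGenInvHom i).comp (artinGenHom i) = MonoidHom.id _ := by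
  ext j
  by_cases h1 : j.val = i.val
  · have hj : j = ⟨i.val, by omega⟩ := Fin.ext h1
    rw [hj]
    simp [artinGenHom, artinGenInvHom, mul_assoc]
  · by_cases h2 : j.val = i.val + 1
    · have hj : j = ⟨i.val + 1, by omega⟩ := Fin.ext h2
      rw [hj]
      simp [artinGenHom, artinGenInvHom]
    · simp [artinGenHom, artinGenInvHom, h1, h2]

theorem artinGenHom_comp {n : ℕ} (i : Fin (n - 1)) :
    (artinGenHom i).comp (artinGenInvHom i) = MonoidHom.id _ := by
  ext j
  by_cases h1 : j.val = i.val
  · have hj : j = ⟨i.val, by omega⟩ := Fin.ext h1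
    rw [hj]
    simp [artinGenHom, artinGenInvHom]
  · by_cases h2 : j.val = i.val + 1
    · have hj : j = ⟨i.val + 1, by omega⟩ := Fin.ext h2
      rw [hj]
      simp [artinGenHom, artinGenInvHom, mul_assoc]
    · simp [artinGenHom, artinGenInvHom, h1, h2]

/-- The automorphism of `F_n` given by an Artin generator. -/
def artinGen {n : ℕ} (i : Fin (n - 1)) : MulAut (FreeGroup (Fin n)) :=
  MonoidHom.toMulEquiv (artinGenHom i) (artinGenInvHom i) (artinGenInvHom_comp i)
    (artinGenHom_comp i)

theorem artinGen_of {n : ℕ} (i : Fin (n - 1)) (j : Fin n) :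
    artinGen i (FreeGroup.of j) =
      if j.val = i.val then
        .of ⟨i.val, by omega⟩ * .of ⟨i.val + 1, by omega⟩ * (.of ⟨i.val, by omega⟩)⁻¹
      else if j.val = i.val + 1 then .of ⟨i.val, by omega⟩
      else .of j := by
  simp [artinGen, artinGenHom]

theorem mulAut_freeGroup_ext {α : Type*} {φ ψ : MulAut (FreeGroup α)}
    (h : ∀ a, φ (FreeGroup.of a) = ψ (FreeGroup.of a)) : φ = ψ := by
  have : φ.toMonoidHom = ψ.toMonoidHom := by
    ext a
    exact h a
  ext x
  exact DFunLike.congr_fun this x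

theorem artinGen_braid {n : ℕ} (i j : Fin (n - 1)) (h : i.val + 1 = j.val) :
    artinGen i * artinGen j * artinGen i = artinGen j * artinGen i * artinGen j := by
  apply mulAut_freeGroup_ext
  intro a
  obtain ⟨j, hj⟩ := j
  simp only at h
  subst h
  have e1 : ¬ i.val = i.val + 1 + 1 := by omega
  have e2 : ¬ i.val + 1 + 1 = i.val := by omega
  by_cases h1 : a.val = i.val
  · have ha : a = ⟨i.val, by omega⟩ := Fin.ext h1
    rw [ha]
    simp [artinGen_of, e1, e2, mul_assoc]
  · by_cases h2 : a.val = i.val + 1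
    · have ha : a = ⟨i.val + 1, by omega⟩ := Fin.ext h2
      rw [ha]
      simp [artinGen_of, e1, e2]
    · by_cases h3 : a.val = i.val + 1 + 1
      · simp [artinGen_of, h3, e1, e2]
      · simp [artinGen_of, h1, h2, h3]

theorem artinGen_comm {n : ℕ} (i j : Fin (n - 1)) (h : i.val + 1 < j.val ∨ j.val + 1 < i.val) :
    artinGen i * artinGen j = artinGen j * artinGen i := by
  apply mulAut_freeGroup_ext
  intro a
  have e1 : ¬ i.val = j.val := by omega
  have e2 : ¬ i.val + 1 = j.val := by omega
  have e3 : ¬ i.val = j.val + 1 := by omega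
  have e1' : ¬ j.val = i.val := by omega
  have e2' : ¬ j.val + 1 = i.val := by omega
  have e3' : ¬ j.val = i.val + 1 := by omega
  by_cases h1 : a.val = i.val
  · simp [artinGen_of, h1, e1, e2, e3]
  · by_cases h2 : a.val = i.val + 1
    · simp [artinGen_of, h2, e1, e2, e3]
    · by_cases h3 : a.val = j.val
      · simp [artinGen_of, h3, e1', e2', e3']
      · by_cases h4 : a.val = j.val + 1
        · simp [artinGen_of, h4, e1', e2', e3']
        · simp [artinGen_of, h1, h2, h3, h4]

/-- The Artin action of `B_n` on `F_n`. It is a right action, hence a homomorphism to the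
opposite of the automorphism group. -/
def artinAction (n : ℕ) : BraidGroup n →* (MulAut (FreeGroup (Fin n)))ᵐᵒᵖ :=
  PresentedGroup.toGroup (f := fun i => MulOpposite.op (artinGen i)) <| by
    rintro r (⟨i, j, h, rfl⟩ | ⟨i, j, h, rfl⟩)
    · simp only [map_mul, map_inv, FreeGroup.lift_apply_of, mul_inv_eq_one, ← MulOpposite.op_mul]
      rw [← mul_assoc, ← mul_assoc, artinGen_braid i j h]
    · simp only [map_mul, map_inv, FreeGroup.lift_apply_of, mul_inv_eq_one, ← MulOpposite.op_mul]
      rw [artinGen_comm i j h]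

namespace BraidGroup

/-- The automorphism `x ↦ x^β` of `F_n` induced by the braid `β`. -/
def toAut {n : ℕ} (β : BraidGroup n) : MulAut (FreeGroup (Fin n)) :=
  (artinAction n β).unop

theorem toAut_σ {n : ℕ} (i : Fin (n - 1)) : (σ i : BraidGroup n).toAut = artinGen i := by
  simp [toAut, σ, artinAction]

theorem toAut_mul_apply {n : ℕ} (β γ : BraidGroup n) (x : FreeGroup (Fin n)) :
    (β * γ).toAut x = γ.toAut (β.toAut x) := by
  simp [toAut]

/-- A braid is order-preserving if its Artin action is an order-preserving automorphism. -/
def OrderPreserving {n : ℕ} (β : BraidGroup n) : Prop :=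
  IsOrderPreserving β.toAut

end BraidGroup

/-! A bi-ordering amounts to a conjugation-invariant positive cone. On a free group with linearly
ordered basis, substitute 1 + X_i for x_i, and call g positive if, in the lowest degree where the
series of g - 1 is nonzero, its lexicographically greatest monomial has positive coefficient
(Magnus). An endomorphism sending each generator to a conjugate of a generator only relabels the
variables in lowest degree, so it preserves positivity if the relabelling is an order automorphism
(`Magnus.Pos.map`).

For even n the braid is pure: the relabelling is trivial. For odd n two generators are swapped,
which no order on three letters allows. Instead (indices from 0) take the kernel of F_3 → ℤ, x_0 ↦
1, x_1, x_2 ↦ 0. It is free on y_{2k} = x_0^k x_2 x_0^{-k} and y_{2k+1} = x_0^k x_1 x_0^{-k}. Up to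
conjugacy in the kernel, x_0 shifts the index by 2, σ_2² by 0 and σ_1²σ_2 by 1, and shifts preserve
the order of ℤ. Ordering F_3 first by the image in ℤ, then by the Magnus ordering of the kernel,
therefore works (`ShiftGroup.pos_embed_map`). -/

/-! ### Positive cones -/

/-- The positive elements of a bi-ordering of a group. -/
structure IsPositiveCone {G : Type*} [Group G] (P : G → Prop) : Prop where
  not_one : ¬ P 1
  mul : ∀ {f g : G}, P f → P g → P (f * g)
  total : ∀ {g : G}, g ≠ 1 → P g ∨ P g⁻¹
  conj : ∀ (h : G) {g : G}, P g → P (h * g * h⁻¹)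

namespace IsPositiveCone

variable {G H : Type*} [Group G] [Group H] {P : G → Prop}

theorem isBiOrdering (hP : IsPositiveCone P) : IsBiOrdering fun f g : G => P (f⁻¹ * g) where
  strictTotal :=
    { irrefl := fun f h => hP.not_one (by simpa using h)
      trans := fun f g h h1 h2 => by simpa [mul_assoc] using hP.mul h1 h2
      trichotomous := fun f g h1 h2 => by
        by_contra hne
        rcases hP.total (g := f⁻¹ * g) (fun h => hne (inv_mul_eq_one.1 h)) with h | h
        · exact h1 h
        · exact h2 (by simpa using h) }
  mul_left := fun f g h hfg => by simpa [mul_assoc] using hfg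
  mul_right := fun f g h hfg => by simpa [mul_assoc] using hP.conj h⁻¹ hfg

/-- By totality one inclusion suffices: if g were negative, φ g would be negative too. -/
theorem map_iff (hP : IsPositiveCone P) {φ : G ≃* G} (h : ∀ g, P g → P (φ g)) (g : G) :
    P (φ g) ↔ P g := by
  refine ⟨fun hg => ?_, h g⟩
  have hne : g ≠ 1 := by
    rintro rfl
    exact hP.not_one (by simpa using hg)
  rcases hP.total hne with h' | h'
  · exact h'
  · exact (hP.not_one (by simpa using hP.mul hg (h _ h'))).elim

theorem isOrderPreserving (hP : IsPositiveCone P) {φ : G ≃* G} (h : ∀ g, P (φ g) ↔ P g) :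
    IsOrderPreserving φ :=
  ⟨_, hP.isBiOrdering, fun f g => by rw [← map_inv, ← map_mul, h]⟩

theorem comap (hP : IsPositiveCone P) (e : H →* G) (he : Function.Injective e) :
    IsPositiveCone fun h => P (e h) where
  not_one := by simpa using hP.not_one
  mul := fun hf hg => by simpa using hP.mul hf hg
  total := fun hg => by
    simpa using hP.total (g := e _) (fun h => hg (he (by simpa using h)))
  conj := fun h g hg => by simpa using hP.conj (e h) hg

end IsPositiveCone

/-- The group automorphisms which preserve a predicate. -/
def predStabilizer {G : Type*} [Group G] (P : G → Prop) : Subgroup (MulAut G) where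
  carrier := {φ | ∀ g, P (φ g) ↔ P g}
  one_mem' := fun _ => Iff.rfl
  mul_mem' := fun {φ ψ} hφ hψ g => (hφ (ψ g)).trans (hψ g)
  inv_mem' := fun {φ} hφ g => by simpa using (hφ (φ⁻¹ g)).symm

/-! ### The Magnus expansion of the group ring -/

namespace Magnus

variable {I : Type*}

theorem freeGroup_left_induction {C : FreeGroup I → Prop} (one : C 1)
    (of_mul : ∀ i g, C g → C (FreeGroup.of i * g))
    (inv_mul : ∀ i g, C g → C ((FreeGroup.of i)⁻¹ * g)) (g : FreeGroup I) : C g := by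
  suffices h : ∀ k g, C g → C (k * g) by simpa using h g 1 one
  intro k
  induction k using FreeGroup.induction_on with
  | C1 => simp
  | of i => exact of_mul i
  | inv_of i _ => exact inv_mul i
  | mul x y hx hy =>
    intro g hg
    rw [mul_assoc]
    exact hx _ (hy _ hg)

/-- The group ring of a free group. -/
abbrev R (I : Type*) : Type _ := MonoidAlgebra ℤ (FreeGroup I)

/-- A group element as an element of the group ring. -/
noncomputable abbrev el (g : FreeGroup I) : R I := MonoidAlgebra.of ℤ (FreeGroup I) g

/-- The element `x_i - 1` of the group ring. -/
noncomputable def X (i : I) : R I := el (FreeGroup.of i) - 1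

theorem el_of_mul (i : I) (g : FreeGroup I) : el (FreeGroup.of i * g) = el g + X i * el g := by
  simp only [X, el, map_mul]
  noncomm_ring

theorem el_inv_mul (i : I) (g : FreeGroup I) :
    el ((FreeGroup.of i)⁻¹ * g) = el g - X i * el ((FreeGroup.of i)⁻¹ * g) := by
  have h := el_of_mul i ((FreeGroup.of i)⁻¹ * g)
  rw [mul_inv_cancel_left] at h
  rw [h]
  abel

/-- Combinations of the `(x_i - 1) b`. -/
noncomputable def combX : (I →₀ R I) →ₗ[ℤ] R I :=
  Finsupp.lsum ℤ fun i => LinearMap.mulLeft ℤ (X i)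

@[simp] theorem combX_single (i : I) (b : R I) : combX (Finsupp.single i b) = X i * b := by
  simp [combX]

/-- The elements `x_{w_1} - 1, …, x_{w_d} - 1` multiplied together. -/
noncomputable def mono (w : List I) : R I := (w.map X).prod

variable [LinearOrder I]

/-- Left multiplication by the variable `X_i` on noncommutative power series, which are
represented by their coefficient functions. -/
def shift (i : I) : Module.End ℤ (List I → ℤ) where
  toFun f
    | [] => 0
    | j :: w => if j = i then f w else 0
  map_add' f g := by
    funext w
    cases w <;> simp [Pi.add_apply]
    split <;> simp
  map_smul' m f := by
    funext w
    cases w <;> simp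

@[simp] theorem shift_nil (i : I) (f : List I → ℤ) : shift i f [] = 0 := rfl

@[simp] theorem shift_cons (i j : I) (f : List I → ℤ) (w : List I) :
    shift i f (j :: w) = if j = i then f w else 0 := rfl

/-- Left multiplication by `(1 + X_i)⁻¹` on coefficient functions. -/
def invFun (i : I) (f : List I → ℤ) : List I → ℤ
  | [] => f []
  | j :: w => f (j :: w) - if j = i then invFun i f w else 0

theorem one_add_shift_invFun (i : I) (f : List I → ℤ) : (1 + shift i) (invFun i f) = f := by
  funext w
  cases w <;> simp [invFun]

theorem invFun_one_add_shift (i : I) (f : List I → ℤ) : invFun i ((1 + shift i) f) = f := by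
  funext w
  induction w with
  | nil => simp [invFun]
  | cons j w ih =>
    rw [invFun, ih]
    simp

/-- Left multiplication by `1 + X_i` as an automorphism. -/
noncomputable def genEquiv (i : I) : (List I → ℤ) ≃ₗ[ℤ] (List I → ℤ) :=
  LinearEquiv.ofBijective (1 + shift i)
    (Function.bijective_iff_has_inverse.2
      ⟨invFun i, invFun_one_add_shift i, one_add_shift_invFun i⟩)

theorem genEquiv_apply (i : I) (f : List I → ℤ) : genEquiv i f = f + shift i f := rfl

theorem genEquiv_inv_apply (i : I) (f : List I → ℤ) : (genEquiv i)⁻¹ f = invFun i f :=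
  (genEquiv i).injective (by
    change genEquiv i ((genEquiv i).symm f) = _
    rw [LinearEquiv.apply_symm_apply]
    exact (one_add_shift_invFun i f).symm)

/-- The Magnus representation of a free group. -/
noncomputable def groupRep (I : Type*) [LinearOrder I] :
    FreeGroup I →* ((List I → ℤ) ≃ₗ[ℤ] (List I → ℤ)) :=
  FreeGroup.lift genEquiv

/-- The Magnus representation of the group ring. -/
noncomputable def rep (I : Type*) [LinearOrder I] : R I →ₐ[ℤ] Module.End ℤ (List I → ℤ) :=
  MonoidAlgebra.lift ℤ _ _
    ((LinearEquiv.automorphismGroup.toLinearMapMonoidHom (R := ℤ) (M := List I → ℤ)).comp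
      (groupRep I))

/-- The power series `1`. -/
def unitSeries : List I → ℤ
  | [] => 1
  | _ :: _ => 0

/-- The coefficient of the monomial `w` in the Magnus expansion. -/
noncomputable def coef (w : List I) : R I →ₗ[ℤ] ℤ where
  toFun a := rep I a unitSeries w
  map_add' a b := by simp
  map_smul' m a := by simp

theorem coef_el (g : FreeGroup I) (w : List I) : coef w (el g) = groupRep I g unitSeries w := by
  simp [coef, rep, el]

theorem rep_X (i : I) : rep I (X i) = shift i := by
  ext f w
  simp [rep, X, el, groupRep, genEquiv_apply]

@[simp] theorem coef_nil_X_mul (i : I) (a : R I) : coef [] (X i * a) = 0 := by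
  simp [coef, rep_X]

@[simp] theorem coef_cons_X_mul (i j : I) (w : List I) (a : R I) :
    coef (j :: w) (X i * a) = if j = i then coef w a else 0 := by
  simp [coef, rep_X]

@[simp] theorem coef_nil_one : coef ([] : List I) 1 = 1 := by
  simp [coef, unitSeries]

@[simp] theorem coef_cons_one (i : I) (w : List I) : coef (i :: w) 1 = 0 := by
  simp [coef, unitSeries]

@[simp] theorem coef_nil_el (g : FreeGroup I) : coef [] (el g) = 1 := by
  induction g using freeGroup_left_induction with
  | one => exact coef_nil_one
  | of_mul i g ih => rw [el_of_mul, map_add, coef_nil_X_mul, ih, add_zero]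
  | inv_mul i g ih => rw [el_inv_mul, map_sub, coef_nil_X_mul, ih, sub_zero]

@[simp] theorem coef_nil_combX (f : I →₀ R I) : coef [] (combX f) = 0 := by
  induction f using Finsupp.induction_linear with
  | zero => simp
  | add f g hf hg => simp [hf, hg]
  | single i b => simp

@[simp] theorem coef_cons_combX (j : I) (w : List I) (f : I →₀ R I) :
    coef (j :: w) (combX f) = coef w (f j) := by
  induction f using Finsupp.induction_linear with
  | zero => simp
  | add f g hf hg => simp [hf, hg]
  | single i b =>
    rw [combX_single, coef_cons_X_mul]
    by_cases h : j = i
    · simp [h]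
    · simp [h, Finsupp.single_eq_of_ne h]

/-- Every element of the group ring is a constant plus a combination of the `(x_i - 1) b`. -/
theorem exists_decomp (a : R I) : ∃ f : I →₀ R I, a = coef [] a • 1 + combX f := by
  suffices h : ∃ (m : ℤ) (f : I →₀ R I), a = m • 1 + combX f by
    obtain ⟨m, f, h⟩ := h
    have hm : coef [] a = m := by rw [h, map_add, map_smul, coef_nil_one, coef_nil_combX]; simp
    exact ⟨f, by rw [hm]; exact h⟩
  induction a using MonoidAlgebra.induction_on with
  | of g =>
    change ∃ (m : ℤ) (f : I →₀ R I), el g = m • 1 + combX f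
    induction g using freeGroup_left_induction with
    | one => exact ⟨1, 0, by rw [map_zero, add_zero, one_smul]; exact map_one _⟩
    | of_mul i g ih =>
      obtain ⟨m, f, h⟩ := ih
      refine ⟨m, f + Finsupp.single i (el g), ?_⟩
      rw [el_of_mul, map_add, combX_single, ← add_assoc, ← h]
    | inv_mul i g ih =>
      obtain ⟨m, f, h⟩ := ih
      refine ⟨m, f - Finsupp.single i (el ((FreeGroup.of i)⁻¹ * g)), ?_⟩
      rw [map_sub, combX_single, ← add_sub_assoc, ← h]
      exact el_inv_mul i g
  | add a b ha hb =>
    obtain ⟨m, f, rfl⟩ := ha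
    obtain ⟨n, g, rfl⟩ := hb
    exact ⟨m + n, f + g, by rw [map_add, add_smul]; abel⟩
  | smul r a ha =>
    obtain ⟨m, f, rfl⟩ := ha
    exact ⟨r * m, r • f, by rw [map_smul, smul_add, mul_smul]⟩

/-! ### The degree filtration and leading coefficients -/

/-- The elements whose Magnus expansion vanishes in degrees less than `d`. -/
noncomputable def J (I : Type*) [LinearOrder I] (d : ℕ) : Submodule ℤ (R I) :=
  ⨅ (w : List I) (_ : w.length < d), LinearMap.ker (coef w)

theorem mem_J {d : ℕ} {a : R I} : a ∈ J I d ↔ ∀ w : List I, w.length < d → coef w a = 0 := by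
  simp [J, Submodule.mem_iInf]

theorem J_anti {d e : ℕ} (h : d ≤ e) : J I e ≤ J I d := fun _ ha =>
  mem_J.2 fun w hw => mem_J.1 ha w (hw.trans_le h)

theorem mem_J_zero (a : R I) : a ∈ J I 0 := mem_J.2 fun _ hw => by simp at hw

theorem el_sub_one_mem (g : FreeGroup I) : el g - 1 ∈ J I 1 := mem_J.2 fun w hw => by
  have : w = [] := List.length_eq_zero_iff.1 (by omega)
  subst this
  rw [map_sub, coef_nil_el, coef_nil_one, sub_self]

theorem X_mul_mem {d : ℕ} (i : I) {a : R I} (ha : a ∈ J I d) : X i * a ∈ J I (d + 1) :=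
  mem_J.2 fun w hw => by
    cases w with
    | nil => simp
    | cons j w =>
      rw [coef_cons_X_mul, mem_J.1 ha w (by simpa using hw), ite_self]

/-- An induction principle for the filtration. -/
theorem J_induction {C : ℕ → R I → Prop} (zero : ∀ a, C 0 a)
    (add : ∀ d a b, C d a → C d b → C d (a + b)) (of_zero : ∀ d, C d 0)
    (X_mul : ∀ d i a, a ∈ J I d → C d a → C (d + 1) (X i * a)) {d : ℕ} {a : R I}
    (ha : a ∈ J I d) : C d a := by
  induction d generalizing a with
  | zero => exact zero a
  | succ d ih =>
    obtain ⟨f, hf⟩ := exists_decomp a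
    -- The constant term vanishes, so a is the sum of the X_i f_i, and each f_i has order at least
    -- d.
    rw [mem_J.1 ha [] (by simp), zero_smul, zero_add] at hf
    have hmem : ∀ i, f i ∈ J I d := fun i => mem_J.2 fun w hw => by
      rw [← coef_cons_combX, ← hf]
      exact mem_J.1 ha _ (by simpa using hw)
    rw [hf, combX, Finsupp.lsum_apply, Finsupp.sum]
    exact Finset.sum_induction _ (C (d + 1)) (add _) (of_zero _)
      fun i _ => X_mul d i _ (hmem i) (ih (hmem i))

/-- Peeling off the factors X_i of a reduces this to d = 0, where J e has to be a left ideal. -/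
theorem mul_mem_J {d e : ℕ} {a b : R I} (ha : a ∈ J I d) (hb : b ∈ J I e) :
    a * b ∈ J I (d + e) := by
  refine J_induction (C := fun d a => a * b ∈ J I (d + e)) ?_ ?_ ?_ ?_ ha
  · intro a
    rw [zero_add]
    induction a using MonoidAlgebra.induction_on with
    | of g =>
      change el g * b ∈ J I e
      induction g using freeGroup_left_induction with
      | one => rwa [el, map_one, one_mul]
      | of_mul i g ih =>
        rw [el_of_mul, add_mul, mul_assoc]
        exact add_mem ih (J_anti (Nat.le_succ e) (X_mul_mem i ih))
      | inv_mul i g ih =>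
        -- `el_inv_mul` has the unknown on both sides, but behind a factor X_i, so induction on w
        -- solves for its coefficients.
        refine mem_J.2 fun w hw => ?_
        induction w with
        | nil => rw [el_inv_mul, sub_mul, map_sub, mul_assoc, coef_nil_X_mul, mem_J.1 ih _ hw,
            sub_zero]
        | cons j w ihw =>
          rw [el_inv_mul, sub_mul, map_sub, mul_assoc, coef_cons_X_mul, mem_J.1 ih _ hw,
            ihw ((Nat.lt_succ_self _).trans hw), ite_self, sub_zero]
    | add x y hx hy => rw [add_mul]; exact add_mem hx hy
    | smul r x hx => rw [smul_mul_assoc]; exact Submodule.smul_mem _ r hx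
  · intro d x y hx hy
    rw [add_mul]
    exact add_mem hx hy
  · intro d
    rw [zero_mul]
    exact zero_mem _
  · intro d i x _ hx
    rw [mul_assoc, Nat.add_right_comm]
    exact X_mul_mem i hx

theorem mono_mem (w : List I) : mono w ∈ J I w.length := by
  induction w with
  | nil => exact mem_J_zero _
  | cons i w ih => simpa [mono] using X_mul_mem i ih

theorem coef_mono (v w : List I) : coef v (mono w) = if v = w then 1 else 0 := by
  induction w generalizing v with
  | nil => cases v <;> simp [mono]
  | cons i w ih =>
    have h : mono (i :: w) = X i * mono w := by simp [mono]
    rw [h]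
    cases v with
    | nil => simp
    | cons j v =>
      rw [coef_cons_X_mul, ih]
      simp only [List.cons.injEq]
      split_ifs <;> simp_all

/-- Modulo `J (d + 1)` the elements of `J d` are combinations of monomials of degree `d`. -/
theorem J_mono_induction {d : ℕ} {C : R I → Prop} (mem : ∀ a ∈ J I (d + 1), C a)
    (mono : ∀ w : List I, w.length = d → C (mono w)) (add : ∀ a b, C a → C b → C (a + b))
    (smul : ∀ (m : ℤ) a, C a → C (m • a)) {a : R I} (ha : a ∈ J I d) : C a := by
  have key : a ∈ Submodule.span ℤ {b | ∃ w : List I, w.length = d ∧ b = Magnus.mono w} ⊔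
      J I (d + 1) := by
    clear mem mono add smul
    refine J_induction (C := fun d a => a ∈ Submodule.span ℤ
      {b | ∃ w : List I, w.length = d ∧ b = Magnus.mono w} ⊔ J I (d + 1)) ?_ ?_ ?_ ?_ ha
    · intro a
      have h : a = coef [] a • Magnus.mono [] + (a - coef [] a • Magnus.mono []) := by abel
      rw [h]
      refine Submodule.add_mem_sup (Submodule.smul_mem _ _ (Submodule.subset_span ⟨[], rfl, rfl⟩))
        (mem_J.2 fun w hw => ?_)
      have : w = [] := List.length_eq_zero_iff.1 (by omega)
      subst this
      rw [map_sub, map_smul, coef_mono]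
      simp
    · exact fun d a b => add_mem
    · exact fun d => zero_mem _
    · intro d i a h0 ha
      clear h0
      obtain ⟨b, hb, c, hc, rfl⟩ := Submodule.mem_sup.1 ha
      rw [mul_add]
      refine Submodule.add_mem_sup ?_ (X_mul_mem i hc)
      induction hb using Submodule.span_induction with
      | mem x hx =>
        obtain ⟨w, hw, rfl⟩ := hx
        exact Submodule.subset_span ⟨i :: w, by simp [hw], by simp [Magnus.mono]⟩
      | zero => simp
      | add x y hx hy h1 h2 =>
        rw [mul_add]
        exact add_mem (h1 (Submodule.add_mem_sup hx hc)) (h2 (Submodule.add_mem_sup hy hc))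
      | smul m x hx h =>
        rw [mul_smul_comm]
        exact Submodule.smul_mem _ _ (h (Submodule.add_mem_sup hx hc))
  obtain ⟨b, hb, c, hc, rfl⟩ := Submodule.mem_sup.1 key
  refine add _ _ ?_ (mem c hc)
  clear key ha
  induction hb using Submodule.span_induction with
  | mem x hx =>
    obtain ⟨w, hw, rfl⟩ := hx
    exact mono w hw
  | zero => exact mem 0 (zero_mem _)
  | add x y _ _ h1 h2 => exact add _ _ h1 h2
  | smul m x _ h => exact smul m x h

/-- For infinite I this is what guarantees a greatest monomial in the leading degree. -/
theorem finite_coef_ne_zero {d : ℕ} {a : R I} (ha : a ∈ J I d) :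
    {w : List I | w.length = d ∧ coef w a ≠ 0}.Finite := by
  refine J_mono_induction (C := fun a => {w : List I | w.length = d ∧ coef w a ≠ 0}.Finite)
    ?_ ?_ ?_ ?_ ha
  · intro a ha
    convert Set.finite_empty
    ext w
    simp only [Set.mem_ofPred_eq, Set.mem_empty_iff_false, iff_false, not_and, not_not]
    exact fun hw => mem_J.1 ha w (by omega)
  · intro w _
    refine (Set.finite_singleton w).subset fun v hv => ?_
    by_contra h
    exact hv.2 (by rw [coef_mono]; exact if_neg h)
  · intro a b h1 h2
    refine (h1.union h2).subset fun w hw => ?_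
    by_contra h
    simp only [Set.mem_union, Set.mem_ofPred_eq, not_or, not_and, not_not] at h
    exact hw.2 (by rw [map_add, h.1 hw.1, h.2 hw.1, add_zero])
  · intro m a h
    refine h.subset fun w hw => ⟨hw.1, fun h0 => hw.2 ?_⟩
    rw [map_smul, h0, smul_zero]

/-- The leading coefficient in degree `d`, with respect to the lexicographic order, is positive. -/
def LeadPos (d : ℕ) (a : R I) : Prop :=
  a ∈ J I d ∧ ∃ w : List I, w.length = d ∧ 0 < coef w a ∧
    ∀ v : List I, v.length = d → w < v → coef v a = 0

theorem LeadPos.congr {d : ℕ} {a b : R I} (h : LeadPos d a) (hab : b - a ∈ J I (d + 1)) :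
    LeadPos d b := by
  have hc : ∀ w : List I, w.length = d → coef w b = coef w a := fun w hw =>
    sub_eq_zero.1 (by rw [← map_sub]; exact mem_J.1 hab w (by omega))
  obtain ⟨ha, w, hw, hpos, hmax⟩ := h
  refine ⟨?_, w, hw, by rwa [hc w hw], fun v hv hwv => by rw [hc v hv, hmax v hv hwv]⟩
  simpa using add_mem (J_anti (Nat.le_succ d) hab) ha

theorem LeadPos.add {d : ℕ} {a b : R I} (ha : LeadPos d a) (hb : LeadPos d b) :
    LeadPos d (a + b) := by
  obtain ⟨ha, w, hw, hpos, hmax⟩ := ha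
  obtain ⟨hb, v, hv, hpos', hmax'⟩ := hb
  refine ⟨add_mem ha hb, ?_⟩
  rcases lt_trichotomy v w with h | h | h
  · refine ⟨w, hw, by rw [map_add, hmax' w hw h, add_zero]; exact hpos, fun u hu h' => ?_⟩
    rw [map_add, hmax u hu h', hmax' u hu (h.trans h'), add_zero]
  · subst h
    refine ⟨v, hw, by rw [map_add]; exact add_pos hpos hpos', fun u hu h' => ?_⟩
    rw [map_add, hmax u hu h', hmax' u hu h', add_zero]
  · refine ⟨v, hv, by rw [map_add, hmax v hv h, zero_add]; exact hpos', fun u hu h' => ?_⟩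
    rw [map_add, hmax u hu (h.trans h'), hmax' u hu h', add_zero]

theorem leadPos_or_neg {d : ℕ} {a : R I} (ha : a ∈ J I d) (ha' : a ∉ J I (d + 1)) :
    LeadPos d a ∨ LeadPos d (-a) := by
  have hne : {w : List I | w.length = d ∧ coef w a ≠ 0}.Nonempty := by
    by_contra h
    rw [Set.not_nonempty_iff_eq_empty] at h
    refine ha' (mem_J.2 fun w hw => ?_)
    rcases (Nat.lt_succ_iff.1 hw).lt_or_eq with h1 | h1
    · exact mem_J.1 ha w h1
    · by_contra h2
      exact (Set.ext_iff.1 h w).1 ⟨h1, h2⟩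
  obtain ⟨w, hw, hmax⟩ := (finite_coef_ne_zero ha).exists_maximal hne
  have hmax' : ∀ v : List I, v.length = d → w < v → coef v a = 0 := fun v hv hwv => by
    by_contra h
    exact absurd (hmax ⟨hv, h⟩ hwv.le) (not_le.2 hwv)
  rcases hw.2.lt_or_gt with h | h
  · refine Or.inr ⟨neg_mem ha, w, hw.1, by rw [map_neg]; omega, fun v hv hwv => ?_⟩
    rw [map_neg, hmax' v hv hwv, neg_zero]
  · exact Or.inl ⟨ha, w, hw.1, h, hmax'⟩

end Magnus

/-! ### The Magnus ordering and its invariance -/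

namespace Magnus

variable {I : Type*}

theorem el_mul_sub_one (g h : FreeGroup I) :
    el (g * h) - 1 = (el g - 1) + (el h - 1) + (el g - 1) * (el h - 1) := by
  simp only [el, map_mul]
  noncomm_ring

theorem map_el (ψ : FreeGroup I →* FreeGroup I) (g : FreeGroup I) :
    MonoidAlgebra.mapDomainRingHom ℤ ψ (el g) = el (ψ g) := by
  simp [el, MonoidAlgebra.mapDomain_single]

variable [LinearOrder I]

/-- The coefficients which witness that a nonempty reduced word with first letter `(i, b)` is
nontrivial: `w` lists the bases of its syllables other than the first. -/
theorem exists_witness (i : I) (b : Bool) (L : List (I × Bool))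
    (hL : FreeGroup.IsReduced ((i, b) :: L)) :
    ∃ w : List I, w.IsChain (· ≠ ·) ∧ w.head? ≠ some i ∧
      groupRep I (FreeGroup.mk ((i, b) :: L)) unitSeries w ≠ 0 ∧
      0 < (bif b then 1 else -1) * (groupRep I (FreeGroup.mk ((i, b) :: L)) unitSeries (i :: w) *
        groupRep I (FreeGroup.mk ((i, b) :: L)) unitSeries w) ∧
      (∀ v : List I, v.IsChain (· ≠ ·) → v.head? ≠ some i → w.length < v.length →
        groupRep I (FreeGroup.mk ((i, b) :: L)) unitSeries v = 0) ∧
      ∀ v : List I, v.IsChain (· ≠ ·) → w.length + 1 < v.length →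
        groupRep I (FreeGroup.mk ((i, b) :: L)) unitSeries v = 0 := by
  -- When v does not begin with j, only the part 1 - X_j of (1 + X_j)⁻¹ contributes at v and at j ::
  -- v.
  have step : ∀ (j : I) (c : Bool) (L : List (I × Bool)) (v : List I), v.head? ≠ some j →
      groupRep I (FreeGroup.mk ((j, c) :: L)) unitSeries v =
        groupRep I (FreeGroup.mk L) unitSeries v ∧
      groupRep I (FreeGroup.mk ((j, c) :: L)) unitSeries (j :: v) =
        groupRep I (FreeGroup.mk L) unitSeries (j :: v) + (bif c then 1 else -1) *
          groupRep I (FreeGroup.mk L) unitSeries v := by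
    intro j c L v hv
    have h : groupRep I (FreeGroup.mk ((j, c) :: L)) =
        (bif c then genEquiv j else (genEquiv j)⁻¹) * groupRep I (FreeGroup.mk L) := by
      simp [groupRep]
    rw [h]
    cases c with
    | true => cases v <;> simp_all [genEquiv_apply]
    | false => cases v <;> simp_all [genEquiv_inv_apply, invFun, sub_eq_add_neg]
  have tail : ∀ (j : I) (c : Bool) (L : List (I × Bool)) (m : ℕ),
      (∀ v : List I, v.IsChain (· ≠ ·) → v.head? ≠ some j → m < v.length →
        groupRep I (FreeGroup.mk L) unitSeries v = 0) →
      (∀ v : List I, v.IsChain (· ≠ ·) → m + 1 < v.length →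
        groupRep I (FreeGroup.mk L) unitSeries v = 0) →
      ∀ v : List I, v.IsChain (· ≠ ·) → m + 1 < v.length →
        groupRep I (FreeGroup.mk ((j, c) :: L)) unitSeries v = 0 := by
    intro j c L m h1 h2 v hv hlen
    by_cases hvj : v.head? = some j
    · obtain ⟨v, rfl⟩ : ∃ v', v = j :: v' := by
        cases v with
        | nil => simp at hvj
        | cons k v => exact ⟨v, by simpa using hvj⟩
      have hvj' : v.head? ≠ some j := by
        cases v with
        | nil => simp
        | cons k v =>
          rw [List.isChain_cons_cons] at hv
          simpa using hv.1.symm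
      rw [(step j c L v hvj').2, h2 _ hv hlen,
        h1 v hv.tail hvj' (by simpa using hlen), mul_zero, add_zero]
    · rw [(step j c L v hvj).1, h2 v hv hlen]
  induction L generalizing i b with
  | nil =>
    have h1 : groupRep I (FreeGroup.mk []) = 1 := map_one _
    have h0 : ∀ (m : ℕ) (v : List I), m < v.length →
        groupRep I (FreeGroup.mk []) unitSeries v = 0 := fun m v hlen => by
      rw [h1]
      cases v with
      | nil => simp at hlen
      | cons => rfl
    refine ⟨[], by simp, by simp, ?_, ?_, fun v hv hvi hlen => ?_,
      tail i b [] 0 (fun v _ _ => h0 _ v) (fun v _ => h0 _ v)⟩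
    · simp [(step i b [] [] (by simp)).1, h1, unitSeries]
    · simp only [(step i b [] [] (by simp)).1, (step i b [] [] (by simp)).2, h1]
      cases b <;> simp [unitSeries]
    · rw [(step i b [] v hvi).1, h0 _ v hlen]
  | cons x L ih =>
    obtain ⟨j, c⟩ := x
    rw [FreeGroup.isReduced_cons_cons] at hL
    obtain ⟨w, hw, hwj, hne, hpos, hvan, hvan'⟩ := ih j c hL.2
    by_cases hij : i = j
    · subst hij
      obtain rfl : b = c := hL.1 rfl
      refine ⟨w, hw, hwj, ?_, ?_, fun v hv hvi hlen => ?_, tail i b _ _ hvan hvan'⟩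
      · rwa [(step i b _ w hwj).1]
      · rw [(step i b _ w hwj).1, (step i b _ w hwj).2]
        -- The syllable grows by a letter of the same sign, so the new term cannot cancel the old
        -- coefficient.
        have := mul_self_pos.2 hne
        cases b <;> simp at hpos ⊢ <;> nlinarith
      · rw [(step i b _ v hvi).1, hvan v hv hvi hlen]
    · have hne' : groupRep I (FreeGroup.mk ((j, c) :: L)) unitSeries (j :: w) ≠ 0 := by
        intro h
        simp [h] at hpos
      have hji : (j :: w).head? ≠ some i := by simpa using Ne.symm hij
      have hchain : (j :: w).IsChain (· ≠ ·) := by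
        cases w with
        | nil => simp
        | cons k w =>
          rw [List.isChain_cons_cons]
          exact ⟨fun h => hwj (by simp [h]), hw⟩
      refine ⟨j :: w, hchain, hji, ?_, ?_, fun v hv hvi hlen => ?_,
        tail i b _ _ (fun v hv _ => hvan' v hv)
          (fun v hv hlen => hvan' v hv ((Nat.lt_succ_self _).trans hlen))⟩
      · rwa [(step i b _ _ hji).1]
      -- A new syllable begins; the old coefficient at i :: j :: w is zero because that word has too
      -- many letters.
      · rw [(step i b _ _ hji).1, (step i b _ _ hji).2, hvan (i :: j :: w)
          (by rw [List.isChain_cons_cons]; exact ⟨hij, hchain⟩) (by simpa using hij)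
          (by simp)]
        have := mul_self_pos.2 hne'
        cases b <;> simp <;> nlinarith
      · rw [(step i b _ v hvi).1]
        exact hvan' v hv hlen

theorem exists_coef_ne_zero {g : FreeGroup I} (hg : g ≠ 1) :
    ∃ w : List I, coef w (el g - 1) ≠ 0 := by
  obtain ⟨L, hL⟩ : ∃ L, L = g.toWord := ⟨_, rfl⟩
  have hred : FreeGroup.IsReduced L := hL ▸ FreeGroup.isReduced_toWord
  have hmk : FreeGroup.mk L = g := by rw [hL, FreeGroup.mk_toWord]
  cases L with
  | nil => exact (hg (by rw [← hmk]; rfl)).elim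
  | cons x L =>
    obtain ⟨i, b⟩ := x
    obtain ⟨w, -, -, -, hpos, -⟩ := exists_witness i b L hred
    refine ⟨i :: w, fun h => ?_⟩
    rw [map_sub, coef_cons_one, sub_zero, coef_el, ← hmk] at h
    simp [h] at hpos

/-- The positive elements of the Magnus ordering of a free group. -/
def Pos (g : FreeGroup I) : Prop := ∃ d, LeadPos (d + 1) (el g - 1)

theorem LeadPos.add_of_mem {d : ℕ} {a b : R I} (ha : LeadPos d a) (hb : b ∈ J I (d + 1)) :
    LeadPos d (a + b) := ha.congr (by simpa using hb)

/-- The difference is [h - 1, g - 1] h⁻¹, and h - 1 has order at least 1. -/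
theorem conj_sub_mem (h : FreeGroup I) {g : FreeGroup I} {d : ℕ} (hg : el g - 1 ∈ J I d) :
    el (h * g * h⁻¹) - 1 - (el g - 1) ∈ J I (d + 1) := by
  have h1 : el (h * g * h⁻¹) - 1 - (el g - 1) =
      ((el h - 1) * (el g - 1) - (el g - 1) * (el h - 1)) * el h⁻¹ := by
    have h2 : el h * el h⁻¹ = 1 := by rw [← map_mul, mul_inv_cancel, map_one]
    have h3 : el (h * g * h⁻¹) = el h * el g * el h⁻¹ := by simp only [el, map_mul]
    have h4 : (el h - 1) * (el g - 1) - (el g - 1) * (el h - 1) = el h * el g - el g * el h := by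
      noncomm_ring
    rw [h4, sub_mul, mul_assoc (el g), h2, h3, mul_one]
    abel
  rw [h1]
  have h2 := mul_mem_J (el_sub_one_mem h) hg
  rw [add_comm 1] at h2
  simpa using mul_mem_J (sub_mem h2 (mul_mem_J hg (el_sub_one_mem h))) (mem_J_zero (el h⁻¹))

theorem isPositiveCone_pos : IsPositiveCone (Pos (I := I)) where
  not_one := by
    rintro ⟨d, -, w, hw, hpos, -⟩
    rw [el, map_one, sub_self, map_zero] at hpos
    exact hpos.false
  mul := by
    rintro g h ⟨d, hg⟩ ⟨e, hh⟩
    rw [Pos]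
    simp only [el_mul_sub_one]
    -- Both degrees are at least 1, so the product term lies strictly above either leading degree.
    have hm := mul_mem_J hg.1 hh.1
    rcases lt_trichotomy d e with hlt | rfl | hlt
    · exact ⟨d, (hg.add_of_mem (J_anti (by omega) hh.1)).add_of_mem (J_anti (by omega) hm)⟩
    · exact ⟨d, (hg.add hh).add_of_mem (J_anti (by omega) hm)⟩
    · rw [add_comm (el g - 1)]
      exact ⟨e, (hh.add_of_mem (J_anti (by omega) hg.1)).add_of_mem (J_anti (by omega) hm)⟩
  total := by
    intro g hg
    have hex : ∃ d, el g - 1 ∉ J I d := by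
      obtain ⟨w, hw⟩ := exists_coef_ne_zero hg
      exact ⟨w.length + 1, fun h => hw (mem_J.1 h w (by simp))⟩
    classical
    obtain ⟨d, hd, hmin⟩ : ∃ d, el g - 1 ∉ J I d ∧ ∀ e < d, el g - 1 ∈ J I e :=
      ⟨Nat.find hex, Nat.find_spec hex, fun e he => not_not.1 (Nat.find_min hex he)⟩
    obtain ⟨d, rfl⟩ : ∃ e, d = e + 1 + 1 := by
      rcases d with _ | _ | d
      · exact (hd (mem_J_zero _)).elim
      · exact (hd (el_sub_one_mem g)).elim
      · exact ⟨d, rfl⟩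
    have hmem := hmin (d + 1) (Nat.lt_succ_self _)
    refine (leadPos_or_neg hmem hd).imp (fun h => ⟨d, h⟩) fun h => ⟨d, h.congr ?_⟩
    have h1 := el_mul_sub_one g⁻¹ g
    rw [inv_mul_cancel, el, map_one, sub_self] at h1
    have h2 : (el g⁻¹ - 1) - -(el g - 1) = -((el g⁻¹ - 1) * (el g - 1)) := by
      rw [eq_neg_iff_add_eq_zero, h1]
      abel
    rw [h2]
    exact neg_mem (J_anti (by omega) (mul_mem_J (el_sub_one_mem _) hmem))
  conj := by
    rintro h g ⟨d, hg⟩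
    exact ⟨d, hg.congr (conj_sub_mem h hg.1)⟩

theorem map_mem_J (ψ : FreeGroup I →* FreeGroup I) {d : ℕ} {a : R I} (ha : a ∈ J I d) :
    MonoidAlgebra.mapDomainRingHom ℤ ψ a ∈ J I d := by
  refine J_induction (C := fun d a => MonoidAlgebra.mapDomainRingHom ℤ ψ a ∈ J I d)
    (fun a => mem_J_zero _) (fun d a b ha hb => ?_) (fun d => ?_) (fun d i a _ ih => ?_) ha
  · rw [map_add]
    exact add_mem ha hb
  · rw [map_zero]
    exact zero_mem _
  · rw [map_mul, add_comm d]
    refine mul_mem_J ?_ ih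
    rw [X, map_sub, map_el, map_one]
    exact el_sub_one_mem _

theorem map_mono_sub_mem {ψ : FreeGroup I →* FreeGroup I} {π : I → I} {h : I → FreeGroup I}
    (hψ : ∀ i, ψ (FreeGroup.of i) = h i * FreeGroup.of (π i) * (h i)⁻¹) (w : List I) :
    MonoidAlgebra.mapDomainRingHom ℤ ψ (mono w) - mono (w.map π) ∈ J I (w.length + 1) := by
  induction w with
  | nil => simp [mono]
  | cons i w ih =>
    have h1 : MonoidAlgebra.mapDomainRingHom ℤ ψ (X i) - X (π i) ∈ J I 2 := by
      rw [X, map_sub, map_el, map_one, hψ]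
      exact conj_sub_mem _ (el_sub_one_mem _)
    have h2 : MonoidAlgebra.mapDomainRingHom ℤ ψ (mono (i :: w)) - mono ((i :: w).map π) =
        (MonoidAlgebra.mapDomainRingHom ℤ ψ (X i) - X (π i)) *
          MonoidAlgebra.mapDomainRingHom ℤ ψ (mono w) +
        X (π i) * (MonoidAlgebra.mapDomainRingHom ℤ ψ (mono w) - mono (w.map π)) := by
      simp only [mono, List.map_cons, List.prod_cons, map_mul]
      noncomm_ring
    rw [h2]
    refine add_mem ?_ (X_mul_mem _ ih)
    have := mul_mem_J h1 (map_mem_J ψ (mono_mem w))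
    rwa [add_comm 2] at this

/-- In degree d, ψ acts as relabelling by π; injectivity keeps distinct monomials distinct. -/
theorem coef_map {ψ : FreeGroup I →* FreeGroup I} {π : I → I} (hπ : Function.Injective π)
    {h : I → FreeGroup I}
    (hψ : ∀ i, ψ (FreeGroup.of i) = h i * FreeGroup.of (π i) * (h i)⁻¹) {d : ℕ} {a : R I}
    (ha : a ∈ J I d) (w : List I) (hw : w.length = d) :
    coef (w.map π) (MonoidAlgebra.mapDomainRingHom ℤ ψ a) = coef w a := by
  refine J_mono_induction (C := fun a =>
    coef (w.map π) (MonoidAlgebra.mapDomainRingHom ℤ ψ a) = coef w a) ?_ ?_ ?_ ?_ ha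
  · intro a ha
    rw [mem_J.1 ha w (by omega), mem_J.1 (map_mem_J ψ ha) _ (by rw [List.length_map]; omega)]
  · intro v hv
    have h1 := mem_J.1 (map_mono_sub_mem hψ v) (w.map π) (by rw [List.length_map]; omega)
    rw [map_sub, sub_eq_zero] at h1
    rw [h1, coef_mono, coef_mono]
    simp only [(List.map_injective_iff.2 hπ).eq_iff]
  · intro a b h1 h2
    rw [map_add, map_add, map_add, h1, h2]
  · intro m a h1
    rw [map_zsmul, map_smul, map_smul, h1]

theorem Pos.map {ψ : FreeGroup I →* FreeGroup I} (π : I ≃o I) {h : I → FreeGroup I}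
    (hψ : ∀ i, ψ (FreeGroup.of i) = h i * FreeGroup.of (π i) * (h i)⁻¹) {g : FreeGroup I}
    (hg : Pos g) : Pos (ψ g) := by
  obtain ⟨d, hmem, w, hw, hpos, hmax⟩ := hg
  have h1 : el (ψ g) - 1 = MonoidAlgebra.mapDomainRingHom ℤ ψ (el g - 1) := by
    rw [map_sub, map_el, map_one]
  refine ⟨d, by rw [h1]; exact map_mem_J ψ hmem, w.map π, by simpa using hw, ?_, ?_⟩
  · rwa [h1, coef_map π.injective hψ hmem w hw]
  · intro v hv hwv
    obtain ⟨u, rfl⟩ := List.map_surjective_iff.2 π.surjective v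
    rw [List.length_map] at hv
    rw [h1, coef_map π.injective hψ hmem u hv]
    refine hmax u hv ?_
    rcases lt_trichotomy w u with h | rfl | h
    · exact h
    · exact (lt_irrefl _ hwv).elim
    · exact (lt_asymm hwv (List.map_lt (fun _ _ => π.lt_iff_lt.2) h)).elim

end Magnus

/-! ### The extension of ℤ by a free group of infinite rank -/

open Magnus

/-- Translations of the generators of a free group on `ℤ` by even numbers. -/
def evenShift : Multiplicative ℤ →* MulAut (FreeGroup ℤ) where
  toFun k := FreeGroup.freeGroupCongr (Equiv.addRight (2 * k.toAdd))
  map_one' := mulAut_freeGroup_ext fun a => by simp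
  map_mul' k l := mulAut_freeGroup_ext fun a => by
    simp [mul_add, add_comm, add_left_comm]

@[simp] theorem evenShift_of (k : Multiplicative ℤ) (a : ℤ) :
    evenShift k (FreeGroup.of a) = FreeGroup.of (a + 2 * k.toAdd) := by
  simp [evenShift]

/-- The extension of `ℤ` by a free group on `ℤ` on which the generator acts by translation. -/
abbrev ShiftGroup : Type := FreeGroup ℤ ⋊[evenShift] Multiplicative ℤ

namespace ShiftGroup

/-- Up to conjugacy in the kernel, only the index a + 2 * `g.right` matters. -/
theorem conj_inl_of (g : ShiftGroup) (a : ℤ) :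
    g * .inl (.of a) * g⁻¹ =
      .inl (g.left * .of (a + 2 * g.right.toAdd) * g.left⁻¹) := by
  ext <;> simp

/-- The positive elements of an ordering of `ShiftGroup`. -/
def Pos (g : ShiftGroup) : Prop := 0 < g.right.toAdd ∨ g.right = 1 ∧ Magnus.Pos g.left

theorem Pos.map {Φ : ShiftGroup →* ShiftGroup} (m : ℤ) (hright : ∀ g, (Φ g).right = g.right)
    (h : ∀ a : ℤ, ∃ (g : ShiftGroup) (b : ℤ), Φ (.inl (.of a)) = g * .inl (.of b) * g⁻¹ ∧
      b + 2 * g.right.toAdd = a + m) {x : ShiftGroup} (hx : Pos x) : Pos (Φ x) := by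
  rcases hx with hx | ⟨h1, h2⟩
  · exact Or.inl (by rwa [hright])
  · refine Or.inr ⟨by rw [hright, h1], ?_⟩
    choose g b hg hb using h
    let ψ : FreeGroup ℤ →* FreeGroup ℤ :=
      -- This is the restriction of Φ to the kernel: a shift by m up to conjugacy.
      FreeGroup.lift fun a => (g a).left * .of (a + m) * (g a).left⁻¹
    have hψ : Φ.comp SemidirectProduct.inl = SemidirectProduct.inl.comp ψ := by
      ext1 a
      rw [MonoidHom.comp_apply, hg, conj_inl_of, hb, MonoidHom.comp_apply, FreeGroup.lift_apply_of]
    have hx : x = .inl x.left := by ext <;> simp [h1]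
    rw [hx]
    have := DFunLike.congr_fun hψ x.left
    rw [MonoidHom.comp_apply, MonoidHom.comp_apply] at this
    rw [this]
    exact Magnus.Pos.map (h := fun a => (g a).left) (OrderIso.addRight m)
      (fun a => by simp [ψ]) h2

theorem isPositiveCone_pos : IsPositiveCone Pos where
  not_one := by
    rintro (h | ⟨-, h⟩)
    · simp at h
    · exact Magnus.isPositiveCone_pos.not_one h
  mul := by
    rintro f g (hf | ⟨hf, hf'⟩) (hg | ⟨hg, hg'⟩)
    · exact Or.inl (by simpa using add_pos hf hg)
    · exact Or.inl (by simpa [hg] using hf)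
    · exact Or.inl (by simpa [hf] using hg)
    · refine Or.inr ⟨by simp [hf, hg], ?_⟩
      simpa [hf] using Magnus.isPositiveCone_pos.mul hf' hg'
  total := by
    intro g hg
    rcases lt_trichotomy 0 g.right.toAdd with h | h | h
    · exact Or.inl (Or.inl h)
    · have h1 : g.right = 1 := h.symm
      have h2 : g.left ≠ 1 := fun h2 => hg (by ext <;> simp [h1, h2])
      refine (Magnus.isPositiveCone_pos.total h2).imp (fun h => Or.inr ⟨h1, h⟩)
        fun h => Or.inr ⟨by simp [h1], by simpa [h1] using h⟩
    · exact Or.inr (Or.inl (by simpa using h))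
  -- Conjugation by h is itself a shift, by twice the image of h in ℤ.
  conj := fun h g hg =>
    Pos.map (Φ := (MulAut.conj h).toMonoidHom) (2 * h.right.toAdd) (fun x => by simp)
      (fun a => ⟨h, a, by simp, rfl⟩) hg

@[simp] theorem right_inr_zpow (k : ℤ) :
    ((.inr (.ofAdd 1) : ShiftGroup) ^ k).right = .ofAdd k := by
  rw [← map_zpow, SemidirectProduct.right_inr, ← ofAdd_zsmul, smul_eq_mul, mul_one]

/-- The embedding of the free group of rank three in `ShiftGroup`. -/
def embed : FreeGroup (Fin 3) →* ShiftGroup :=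
  -- Even indices carry the conjugates of x_2 and odd ones those of x_1.
  FreeGroup.lift ![.inr (.ofAdd 1), .inl (.of 1), .inl (.of 0)]

/-- The left inverse of `embed`. -/
def retract : ShiftGroup →* FreeGroup (Fin 3) :=
  SemidirectProduct.lift
    (FreeGroup.lift fun a => .of 0 ^ (a / 2) * .of (if 2 ∣ a then 2 else 1) *
      (.of 0 ^ (a / 2))⁻¹)
    (zpowersHom _ (.of 0)) fun k => by
      ext1 a
      have h1 : (a + 2 * k.toAdd) / 2 = k.toAdd + a / 2 := by omega
      have h2 : 2 ∣ a + 2 * k.toAdd ↔ 2 ∣ a := by omega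
      have h3 (x : FreeGroup (Fin 3)) : (MulAut.conj (FreeGroup.of 0) ^ k.toAdd) x =
          .of 0 ^ k.toAdd * x * (.of 0 ^ k.toAdd)⁻¹ := by
        rw [← map_zpow, MulAut.conj_apply]
      simp [h1, h2, h3, zpow_add, mul_assoc]

theorem retract_embed (g : FreeGroup (Fin 3)) : retract (embed g) = g := by
  have h : retract.comp embed = MonoidHom.id _ := by
    ext1 i
    fin_cases i <;> simp [retract, embed]
  exact DFunLike.congr_fun h g

theorem embed_injective : Function.Injective embed :=
  Function.LeftInverse.injective retract_embed

theorem embed_right_map {φ : FreeGroup (Fin 3) →* FreeGroup (Fin 3)}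
    (h : ∀ i, (embed (φ (.of i))).right = (embed (.of i)).right) (g : FreeGroup (Fin 3)) :
    (embed (φ g)).right = (embed g).right := by
  have h' : (SemidirectProduct.rightHom.comp embed).comp φ =
      SemidirectProduct.rightHom.comp embed := by
    ext1 i
    exact h i
  exact DFunLike.congr_fun h' g

theorem embed_retract_right (x : ShiftGroup) : (embed (retract x)).right = x.right := by
  have h' : (SemidirectProduct.rightHom.comp embed).comp retract =
      SemidirectProduct.rightHom := by
    refine SemidirectProduct.hom_ext ?_ ?_
    · ext1 a
      by_cases ha : 2 ∣ a <;> simp [retract, embed, ha]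
    · ext1
      simp [retract, embed]
  exact DFunLike.congr_fun h' x

/-- The ordering of the free group of rank three induced from `ShiftGroup` is preserved by the
endomorphisms which act by a translation on the generators `x_0 ^ k * x_i * x_0 ^ (-k)`. -/
theorem pos_embed_map (φ : FreeGroup (Fin 3) ≃* FreeGroup (Fin 3)) (m : ℤ)
    (hright : ∀ i, (embed (φ (.of i))).right = (embed (.of i)).right)
    (h1 : ∀ k : ℤ, ∃ (g : FreeGroup (Fin 3)) (b : ℤ),
      embed (φ (.of 0) ^ k * φ (.of 1) * (φ (.of 0) ^ k)⁻¹) =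
        embed g * .inl (.of b) * (embed g)⁻¹ ∧
      b + 2 * (embed g).right.toAdd = 2 * k + 1 + m)
    (h2 : ∀ k : ℤ, ∃ (g : FreeGroup (Fin 3)) (b : ℤ),
      embed (φ (.of 0) ^ k * φ (.of 2) * (φ (.of 0) ^ k)⁻¹) =
        embed g * .inl (.of b) * (embed g)⁻¹ ∧
      b + 2 * (embed g).right.toAdd = 2 * k + m) {g : FreeGroup (Fin 3)}
    (hg : Pos (embed g)) : Pos (embed (φ g)) := by
  -- φ is transported to `ShiftGroup`; `retract_embed` brings the conclusion back.
  have := Pos.map (Φ := (embed.comp φ.toMonoidHom).comp retract) m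
    (fun x => (embed_right_map (φ := φ.toMonoidHom) hright _).trans (embed_retract_right x))
    (fun a => ?_) hg
  · simpa [retract_embed] using this
  · by_cases ha : 2 ∣ a
    · obtain ⟨g, b, h, hb⟩ := h2 (a / 2)
      refine ⟨embed g, b, ?_, by omega⟩
      rw [← h]
      simp [retract, ha]
    · obtain ⟨g, b, h, hb⟩ := h1 (a / 2)
      refine ⟨embed g, b, ?_, by omega⟩
      rw [← h]
      simp [retract, ha]

end ShiftGroup

/-! ### The braids σ_1², σ_2² and σ_1²σ_2 -/

namespace BraidGroup

theorem toAut_mul {n : ℕ} (β γ : BraidGroup n) : (β * γ).toAut = γ.toAut * β.toAut :=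
  MulEquiv.ext (toAut_mul_apply β γ)

theorem toAut_zpow {n : ℕ} (β : BraidGroup n) (k : ℤ) : (β ^ k).toAut = β.toAut ^ k := by
  simp [toAut]

end BraidGroup

open BraidGroup

theorem artinGen_zero_sq_apply (i : Fin 3) :
    (artinGen (n := 3) (0 : Fin 2) ^ 2) (.of i) =
      if i = 2 then .of 2 else (.of 0 * .of 1) * .of i * (.of 0 * .of 1)⁻¹ := by
  fin_cases i <;> simp [sq, artinGen_of, mul_assoc]

theorem artinGen_one_sq_apply (i : Fin 3) :
    (artinGen (n := 3) (1 : Fin 2) ^ 2) (.of i) =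
      if i = 0 then .of 0 else (.of 1 * .of 2) * .of i * (.of 1 * .of 2)⁻¹ := by
  fin_cases i <;> simp [sq, artinGen_of, mul_assoc]

theorem pos_artinGen_zero_sq {g : FreeGroup (Fin 3)} (hg : Pos g) :
    Pos ((artinGen (n := 3) (0 : Fin 2) ^ 2) g) :=
  Pos.map (ψ := (artinGen (n := 3) (0 : Fin 2) ^ 2).toMonoidHom)
    (h := fun i => if i = 2 then 1 else .of 0 * .of 1) (OrderIso.refl _)
    (fun i => (artinGen_zero_sq_apply i).trans (by fin_cases i <;> simp)) hg

theorem pos_artinGen_one_sq {g : FreeGroup (Fin 3)} (hg : Pos g) :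
    Pos ((artinGen (n := 3) (1 : Fin 2) ^ 2) g) :=
  Pos.map (ψ := (artinGen (n := 3) (1 : Fin 2) ^ 2).toMonoidHom)
    (h := fun i => if i = 0 then 1 else .of 1 * .of 2) (OrderIso.refl _)
    (fun i => (artinGen_one_sq_apply i).trans (by fin_cases i <;> simp)) hg

theorem pos_embed_artinGen_one_sq {g : FreeGroup (Fin 3)}
    (hg : ShiftGroup.Pos (ShiftGroup.embed g)) :
    ShiftGroup.Pos (ShiftGroup.embed ((artinGen (n := 3) (1 : Fin 2) ^ 2) g)) := by
  refine ShiftGroup.pos_embed_map (artinGen (n := 3) (1 : Fin 2) ^ 2) 0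
    (fun i => ?_) (fun k => ⟨.of 0 ^ k * (.of 1 * .of 2), 1, ?_, ?_⟩)
    (fun k => ⟨.of 0 ^ k * (.of 1 * .of 2), 0, ?_, ?_⟩) hg
  · rw [artinGen_one_sq_apply]
    fin_cases i <;> simp [ShiftGroup.embed]
  · rw [artinGen_one_sq_apply, artinGen_one_sq_apply]
    simp [ShiftGroup.embed, mul_assoc]
  · simp [ShiftGroup.embed]
    ring
  · rw [artinGen_one_sq_apply, artinGen_one_sq_apply]
    simp [ShiftGroup.embed, mul_assoc]
  · simp [ShiftGroup.embed]

/-- With c = x_0 x_1 x_2 x_1⁻¹, this form shows x_0 conjugated by c and x_1, x_2 interchanged up to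
conjugacy. -/
theorem artinGen_mixed_apply (i : Fin 3) :
    (artinGen (n := 3) (1 : Fin 2) * artinGen (n := 3) (0 : Fin 2) ^ 2) (.of i) =
      if i = 2 then .of 1 else (.of 0 * .of 1 * .of 2 * (.of 1)⁻¹) *
        (if i = 0 then .of 0 else .of 1 * .of 2 * (.of 1)⁻¹) *
        (.of 0 * .of 1 * .of 2 * (.of 1)⁻¹)⁻¹ := by
  rw [MulAut.mul_apply, artinGen_zero_sq_apply]
  fin_cases i <;> simp [artinGen_of, mul_assoc]

theorem pos_embed_artinGen_mixed {g : FreeGroup (Fin 3)}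
    (hg : ShiftGroup.Pos (ShiftGroup.embed g)) :
    ShiftGroup.Pos (ShiftGroup.embed
      ((artinGen (n := 3) (1 : Fin 2) * artinGen (n := 3) (0 : Fin 2) ^ 2) g)) := by
  -- The image of y_{2k+1} is y_0 conjugated by c x_0^k x_1, of exponent k + 1 in x_0, giving index
  -- 2k + 2. That of y_{2k} is y_1 conjugated by c x_0^k c⁻¹, giving 2k + 1.
  refine ShiftGroup.pos_embed_map
    (artinGen (n := 3) (1 : Fin 2) * artinGen (n := 3) (0 : Fin 2) ^ 2) 1
    (fun i => ?_) (fun k => ⟨(.of 0 * .of 1 * .of 2 * (.of 1)⁻¹) * .of 0 ^ k * .of 1, 0, ?_, ?_⟩)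
    (fun k => ⟨(.of 0 * .of 1 * .of 2 * (.of 1)⁻¹) * .of 0 ^ k *
      (.of 0 * .of 1 * .of 2 * (.of 1)⁻¹)⁻¹, 1, ?_, ?_⟩) hg
  · rw [artinGen_mixed_apply]
    fin_cases i <;> simp [ShiftGroup.embed]
  · rw [artinGen_mixed_apply, artinGen_mixed_apply]
    simp only [Fin.isValue, Fin.reduceEq, ↓reduceIte, conj_zpow]
    simp [ShiftGroup.embed, mul_assoc]
  · simp [ShiftGroup.embed]
    ring
  · rw [artinGen_mixed_apply, artinGen_mixed_apply]
    simp only [Fin.isValue, Fin.reduceEq, ↓reduceIte, conj_zpow]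
    simp [ShiftGroup.embed, mul_assoc]
  · simp [ShiftGroup.embed]
    ring

theorem mainTheorem6 (n : ℤ) :
    (BraidGroup.σ (n := 3) (0 : Fin 2) ^ 2 *
      BraidGroup.σ (n := 3) (1 : Fin 2) ^ n).OrderPreserving := by
  have h0 : (BraidGroup.σ (n := 3) (0 : Fin 2) ^ 2 * BraidGroup.σ (n := 3) (1 : Fin 2) ^ n).toAut =
      artinGen (n := 3) (1 : Fin 2) ^ n * artinGen (n := 3) (0 : Fin 2) ^ 2 := by
    rw [toAut_mul, toAut_zpow, ← zpow_natCast, toAut_zpow, toAut_σ, toAut_σ]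
    rfl
  rw [OrderPreserving, h0]
  obtain ⟨m, rfl | rfl⟩ := Int.even_or_odd' n
  · have hP := isPositiveCone_pos (I := Fin 3)
    -- Membership in the stabilizer subgroup handles negative m as well.
    refine hP.isOrderPreserving ((predStabilizer Pos).mul_mem ?_
      (hP.map_iff fun _ => pos_artinGen_zero_sq))
    rw [zpow_mul]
    exact (predStabilizer Pos).zpow_mem (hP.map_iff fun _ => pos_artinGen_one_sq) m
  · have hP := ShiftGroup.isPositiveCone_pos.comap _ ShiftGroup.embed_injective
    -- One factor σ_2 joins σ_1²; the remaining σ_2^{2m} shifts by 0.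
    rw [zpow_add, zpow_mul, zpow_one, mul_assoc]
    let S := predStabilizer fun g => ShiftGroup.Pos (ShiftGroup.embed g)
    exact hP.isOrderPreserving (S.mul_mem
      (S.zpow_mem (hP.map_iff fun _ => pos_embed_artinGen_one_sq) m)
      (hP.map_iff fun _ => pos_embed_artinGen_mixed))
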